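/- Let $\Lambda=\{\lambda_1,\dots,\lambda_n\}$ be a set of $n$ distinct real numbers which is strongly disjoint: any two disjoint nonempty subsets of $\Lambda$ have different averages. Let $\mathrm{Sym}(\Lambda)$ be the manifold of real symmetric $n\times n$ matrices with set of eigenvalues $\Lambda$, with tangent spaces $T_H\mathrm{Sym}(\Lambda)=\{[H,\Omega]:\Omega^T=-\Omega\}$ and the normal metric $g([H,\Omega_1],[H,\Omega_2])=-\mathrm{tr}(\Omega_1\Omega_2)$, and let $\Psi(H)=\frac12\sum_{i=1}^n d_i^2$ be the diagonal potential, where $d_1,\dots,d_n$ are the diagonal entries of $H$. For an ordered partition $\alpha=(\Lambda_1,\dots,\Lambda_k)$ of $\Lambda$ into nonempty subsets, let $E_\alpha$ be the set of block-diagonal matrices $\mathrm{Diag}(H_1,\dots,H_k)$ such that, for each $p$, $H_p\in\mathrm{Sym}(\Lambda_p)$ and all diagonal entries of $H_p$ are equal to the average of $\Lambda_p$. A critical manifold of $\Psi$ is a set of the form $P^TE_\alpha P$ with $\alpha$ an ordered partition of $\Lambda$ and $P$ a permutation matrix. The co-index of a critical manifold $E$ at $H\in E$ is the number of positive eigenvalues,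 counted with multiplicity, of the Hessian of $\Psi$ at $H$ restricted to the normal space $N_HE$ of $E$ in $T_H\mathrm{Sym}(\Lambda)$ (both taken with respect to $g$). For every critical manifold $E$ the following are equivalent: (i) $E$ is stable, that is, its co-index is $0$ at some point of $E$; (ii) the co-index of $E$ is $0$ at every point of $E$; (iii) $E$ is a singleton consisting of a diagonal matrix. -/

import Mathlib

open scoped Matrix ContDiff

noncomputable section

namespace DiagonalPotential

/-- The average `μ(A)` of a finite set of real numbers. -/
def mean (A : Finset ℝ) : ℝ := (∑ x ∈ A, x) / (A.card : ℝ)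

/-- Nonempty disjoint subsets of `Λ` have different averages. -/
def StronglyDisjoint (Λ : Finset ℝ) : Prop :=
  ∀ A B : Finset ℝ, A ⊆ Λ → B ⊆ Λ → A.Nonempty → B.Nonempty → Disjoint A B → mean A ≠ mean B

/-- Real square matrices of size `n = #Λ`. -/
abbrev Mat (Λ : Finset ℝ) : Type := Matrix (Fin Λ.card) (Fin Λ.card) ℝ

/-- The isospectral manifold `Sym(Λ)`: symmetric matrices of size `#Λ` whose eigenvalues,
counted with multiplicity, are the elements of `Λ`. -/
def isospectral (Λ : Finset ℝ) : Set (Mat Λ) :=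
  {H | H.IsSymm ∧ H.charpoly = ∏ x ∈ Λ, (Polynomial.X - Polynomial.C x)}

/-! ### Riemannian structure -/

/-- `T_H Sym(Λ)`, the set of all `[H, Ω]` with `Ω` skew symmetric. -/
def tangentSpace {Λ : Finset ℝ} (H : Mat Λ) : Set (Mat Λ) :=
  {X | ∃ Ω : Mat Λ, Ωᵀ = -Ω ∧ ⁅H, Ω⁆ = X}

open Classical in
/-- The inverse of `ad_H : Ω ↦ [H, Ω]` on tangent vectors: the skew symmetric `Ω` with
`[H, Ω] = X`, which is unique when the eigenvalues of the symmetric matrix `H` are distinct.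
(It is `0` if `X` is not tangent.) -/
def adInv {Λ : Finset ℝ} (H X : Mat Λ) : Mat Λ :=
  if h : ∃ Ω : Mat Λ, Ωᵀ = -Ω ∧ ⁅H, Ω⁆ = X then h.choose else 0

/-- The normal metric, `g([H, Ω₁], [H, Ω₂]) = -tr(Ω₁ Ω₂)`. -/
def normalMetric {Λ : Finset ℝ} (H X Y : Mat Λ) : ℝ :=
  -(adInv H X * adInv H Y).trace

/-- The diagonal potential `Ψ(H) = (1/2) ∑ d_i²`, `d_i` the diagonal entries of `H`. -/
def potential {Λ : Finset ℝ} (H : Mat Λ) : ℝ := (1 / 2) * ∑ i, H i i ^ 2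

/-- The Hessian of the diagonal potential at an equilibrium `H`, on tangent vectors `X, Y`:
`X (Ỹ Ψ) = X (g(grad Ψ, Ỹ))`, where `Ỹ` is the tangent vector field `K ↦ [K, Ω]` on `Sym(Λ)`
that extends `Y = [H, Ω]`. -/
def hessian {Λ : Finset ℝ} (H X Y : Mat Λ) : ℝ :=
  lineDeriv ℝ (fun K : Mat Λ => lineDeriv ℝ potential K ⁅K, adInv H Y⁆) H X

/-- Tangent vectors at `H` to a submanifold `E`: velocities at time `0` of smooth curves in `E`
through `H`. -/
def tangentVectors {Λ : Finset ℝ} (E : Set (Mat Λ)) (H : Mat Λ) : Set (Mat Λ) :=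
  {X | ∃ γ : ℝ → Mat Λ, (∀ i j, ContDiff ℝ ∞ (fun t => γ t i j)) ∧ (∀ t, γ t ∈ E) ∧ γ 0 = H ∧
    ∀ i j, X i j = deriv (fun t => γ t i j) 0}

/-- The normal space `N_H E` in `T_H Sym(Λ)` with respect to the normal metric. -/
def normalSpace {Λ : Finset ℝ} (E : Set (Mat Λ)) (H : Mat Λ) : Set (Mat Λ) :=
  {X | X ∈ tangentSpace H ∧ ∀ Y ∈ tangentVectors E H, normalMetric H X Y = 0}

/-- Eigenvectors of the Hessian restricted to `N_H E` for the eigenvalue `c` (and zero): those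
`X` in `N_H E` whose image `L X` under the operator `L` on `N_H E` given by
`g(L X, Y) = Hess(X, Y)` is `c X`. -/
def eigenvectors {Λ : Finset ℝ} (E : Set (Mat Λ)) (H : Mat Λ) (c : ℝ) : Set (Mat Λ) :=
  {X | X ∈ normalSpace E H ∧ ∀ Y ∈ normalSpace E H, hessian H X Y = c * normalMetric H X Y}

/-- The co-index of `E` computed at `H ∈ E`: the number of positive eigenvalues, with
multiplicity, of the Hessian restricted to `N_H E`, that is, the dimension of the sum of the
eigenspaces of positive eigenvalues. -/
def coindexAt {Λ : Finset ℝ} (E : Set (Mat Λ)) (H : Mat Λ) : ℕ :=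
  Module.finrank ℝ (Submodule.span ℝ (⋃ c ∈ Set.Ioi (0 : ℝ), eigenvectors E H c))

/-! ### Critical manifolds -/

/-- An ordered partition `(Λ_1, …, Λ_k)` of `Λ` into nonempty parts. -/
structure OrderedPartition (Λ : Finset ℝ) where
  k : ℕ
  part : Fin k → Finset ℝ
  nonempty : ∀ p, (part p).Nonempty
  disjoint : ∀ p q, p ≠ q → Disjoint (part p) (part q)
  union : Finset.univ.biUnion part = Λ

theorem OrderedPartition.sum_card {Λ : Finset ℝ} (α : OrderedPartition Λ) :
    ∑ p, (α.part p).card = Λ.card := by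
  rw [← Finset.card_biUnion (fun p _ q _ h => α.disjoint p q h), α.union]

/-- The consecutive numbering of the rows of a block matrix with blocks of sizes `#Λ_1, …, #Λ_k`. -/
def OrderedPartition.index {Λ : Finset ℝ} (α : OrderedPartition Λ) :
    ((p : Fin α.k) × Fin (α.part p).card) ≃ Fin Λ.card :=
  finSigmaFinEquiv.trans (finCongr α.sum_card)

/-- `E_α`: the matrices `Diag(H_1, …, H_k)` with `H_p ∈ Sym(Λ_p)` and all diagonal entries of `H_p`
equal to `μ(Λ_p)`. -/
def blockEquilibria {Λ : Finset ℝ} (α : OrderedPartition Λ) : Set (Mat Λ) :=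
  {H | ∃ B : (p : Fin α.k) → Mat (α.part p),
    (∀ p, B p ∈ isospectral (α.part p)) ∧ (∀ p i, B p i i = mean (α.part p)) ∧
    H = Matrix.reindex α.index α.index (Matrix.blockDiagonal' B)}

/-- A critical manifold of the diagonal potential: a set `Pᵀ E_α P` with `P` a permutation matrix. -/
def IsCriticalManifold {Λ : Finset ℝ} (E : Set (Mat Λ)) : Prop :=
  ∃ (α : OrderedPartition Λ) (σ : Equiv.Perm (Fin Λ.card)),
    E = (fun H => (σ.permMatrix ℝ)ᵀ * H * σ.permMatrix ℝ) '' blockEquilibria α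

end DiagonalPotential

end

noncomputable section

namespace DiagonalPotential

/-! Let `D` be the diagonal part of `H ∈ E`. On skew matrices the Hessian reads `Hess([H,A],[H,B]) =
∑ [H,A]_ii [H,B]_ii + tr(D [[H,A],B])`. The diagonal is constant on blocks, so `D` commutes with
`H`, and the form is symmetric by the Jacobi identity. If some off-diagonal `H i j` is nonzero, then
`H i i = H j j`, and the generator of the `(i, j)`-rotation commutes with `D`. The second term
vanishes, the first is positive (`exists_skewHessian_pos`), and the form has a positive eigenvalue
(`exists_pos_eigenvector`). Velocities of curves in `E` that are tangent to `Sym(Λ)` lie in the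
kernel of the Hessian, so the eigenvector is automatically normal to `E`, and the co-index is
positive. If `H` is diagonal, `Hess(X,X) = -tr(X Xᵀ) ≤ 0`, so the co-index is 0. A diagonal block
with constant diagonal is scalar, hence of size 1 because its eigenvalues are distinct, so `E` is a
point. -/

/-! ### Simple spectrum and injectivity of `ad_H`. -/

/-- A matrix that an orthogonal matrix conjugates to a diagonal matrix with distinct entries in
`S`. -/
def HasSimpleSpectrumIn {n : Type*} [Fintype n] [DecidableEq n] (M : Matrix n n ℝ)
    (S : Set ℝ) : Prop :=
  ∃ (U : Matrix n n ℝ) (d : n → ℝ), Uᵀ * U = 1 ∧ U * Uᵀ = 1 ∧ Function.Injective d ∧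
    (∀ i, d i ∈ S) ∧ M = U * Matrix.diagonal d * Uᵀ

theorem hasSimpleSpectrumIn_of_mem_isospectral {A : Finset ℝ} {M : Mat A}
    (hM : M ∈ isospectral A) : HasSimpleSpectrumIn M (A : Set ℝ) := by
  obtain ⟨hs, hc⟩ := hM
  have hH : M.IsHermitian := by
    rw [Matrix.IsHermitian, Matrix.conjTranspose_eq_transpose_of_trivial]; exact hs
  have hr : Multiset.map hH.eigenvalues Finset.univ.val = A.val := by
    have h1 := hH.roots_charpoly_eq_eigenvalues
    rw [hc, Polynomial.roots_prod_X_sub_C] at h1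
    simpa using h1.symm
  refine ⟨hH.eigenvectorUnitary, hH.eigenvalues, ?_, ?_, ?_, ?_, ?_⟩
  · have := Matrix.UnitaryGroup.star_mul_self hH.eigenvectorUnitary
    rwa [Matrix.star_eq_conjTranspose, Matrix.conjTranspose_eq_transpose_of_trivial] at this
  · have := (Matrix.mem_unitaryGroup_iff).1 hH.eigenvectorUnitary.2
    rwa [Matrix.star_eq_conjTranspose, Matrix.conjTranspose_eq_transpose_of_trivial] at this
  · have h2 : (Multiset.map hH.eigenvalues Finset.univ.val).Nodup := hr ▸ A.nodup
    intro i j hij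
    exact Multiset.inj_on_of_nodup_map h2 i (Finset.mem_univ i) j (Finset.mem_univ j) hij
  · intro i
    have : hH.eigenvalues i ∈ A.val := by
      rw [← hr]; exact Multiset.mem_map_of_mem _ (Finset.mem_univ i)
    simpa using this
  · have := hH.spectral_theorem
    rw [Unitary.conjStarAlgAut_apply, Matrix.star_eq_conjTranspose,
      Matrix.conjTranspose_eq_transpose_of_trivial] at this
    simpa using this

theorem HasSimpleSpectrumIn.submatrix {m n : Type*} [Fintype n] [DecidableEq n] [Fintype m]
    [DecidableEq m] {M : Matrix n n ℝ} {S : Set ℝ} (h : HasSimpleSpectrumIn M S) (e : m ≃ n) :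
    HasSimpleSpectrumIn (M.submatrix e e) S := by
  obtain ⟨U, d, h1, h2, h3, h4, h5⟩ := h
  refine ⟨U.submatrix e e, d ∘ e, ?_, ?_, h3.comp e.injective, fun i => h4 _, ?_⟩
  · rw [Matrix.transpose_submatrix, Matrix.submatrix_mul_equiv, h1, Matrix.submatrix_one_equiv]
  · rw [Matrix.transpose_submatrix, Matrix.submatrix_mul_equiv, h2, Matrix.submatrix_one_equiv]
  · rw [← Matrix.submatrix_diagonal_equiv, Matrix.transpose_submatrix,
      Matrix.submatrix_mul_equiv, Matrix.submatrix_mul_equiv, h5]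

/-- Eigenvalues of different blocks differ because they lie in disjoint sets; this is why the
predicate records the set `S`. -/
theorem HasSimpleSpectrumIn.blockDiagonal' {o : Type*} [Fintype o] [DecidableEq o]
    {n : o → Type*} [∀ p, Fintype (n p)] [∀ p, DecidableEq (n p)]
    {B : ∀ p, Matrix (n p) (n p) ℝ} {S : o → Set ℝ} (h : ∀ p, HasSimpleSpectrumIn (B p) (S p))
    (hS : ∀ p q, p ≠ q → Disjoint (S p) (S q)) :
    HasSimpleSpectrumIn (Matrix.blockDiagonal' B) (⋃ p, S p) := by
  choose U d h1 h2 h3 h4 h5 using h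
  refine ⟨Matrix.blockDiagonal' U, fun x => d x.1 x.2, ?_, ?_, ?_, ?_, ?_⟩
  · rw [Matrix.blockDiagonal'_transpose, ← Matrix.blockDiagonal'_mul, funext h1]
    exact Matrix.blockDiagonal'_one
  · rw [Matrix.blockDiagonal'_transpose, ← Matrix.blockDiagonal'_mul, funext h2]
    exact Matrix.blockDiagonal'_one
  · rintro ⟨p, i⟩ ⟨q, j⟩ hij
    by_cases hpq : p = q
    · subst hpq
      exact congrArg (Sigma.mk p) (h3 p hij)
    · refine (Set.disjoint_left.1 (hS p q hpq) (h4 p i) ?_).elim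
      rw [show d p i = d q j from hij]
      exact h4 q j
  · exact fun x => Set.mem_iUnion.2 ⟨x.1, h4 _ _⟩
  · rw [← Matrix.blockDiagonal'_diagonal, Matrix.blockDiagonal'_transpose,
      ← Matrix.blockDiagonal'_mul, ← Matrix.blockDiagonal'_mul, ← funext h5]

theorem HasSimpleSpectrumIn.isSymm {n : Type*} [Fintype n] [DecidableEq n] {M : Matrix n n ℝ}
    {S : Set ℝ} (h : HasSimpleSpectrumIn M S) : M.IsSymm := by
  obtain ⟨U, d, -, -, -, -, rfl⟩ := h
  simp [Matrix.IsSymm, Matrix.transpose_mul, Matrix.mul_assoc]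

/-- `ad_H` is injective on skew symmetric matrices if the symmetric matrix `H` has simple
spectrum. -/
theorem HasSimpleSpectrumIn.eq_zero_of_lie_eq_zero {n : Type*} [Fintype n] [DecidableEq n]
    {M : Matrix n n ℝ} {S : Set ℝ} (h : HasSimpleSpectrumIn M S) {Ω : Matrix n n ℝ}
    (hΩ : Ωᵀ = -Ω) (hl : ⁅M, Ω⁆ = 0) : Ω = 0 := by
  obtain ⟨U, d, h1, h2, h3, -, h5⟩ := h
  -- In an eigenbasis, commuting with `M` means `(d i - d j) * K i j = 0`, which kills the
  -- off-diagonal entries; skewness kills the diagonal.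
  set K := Uᵀ * Ω * U with hK
  have hcomm : Matrix.diagonal d * K = K * Matrix.diagonal d := by
    have hM : Matrix.diagonal d = Uᵀ * M * U := by
      rw [h5]
      calc Matrix.diagonal d = (Uᵀ * U) * Matrix.diagonal d * (Uᵀ * U) := by simp [h1]
        _ = _ := by simp only [Matrix.mul_assoc]
    rw [Ring.lie_def, sub_eq_zero] at hl
    calc Matrix.diagonal d * K = Uᵀ * M * (U * Uᵀ) * Ω * U := by
            rw [hM, hK]; simp only [Matrix.mul_assoc]
      _ = Uᵀ * (M * Ω) * U := by rw [h2]; simp only [Matrix.mul_assoc, Matrix.mul_one]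
      _ = Uᵀ * Ω * (U * Uᵀ) * M * U := by
            rw [h2, hl]; simp only [Matrix.mul_assoc, Matrix.mul_one]
      _ = K * Matrix.diagonal d := by rw [hM, hK]; simp only [Matrix.mul_assoc]
  have hskew : Kᵀ = -K := by
    rw [hK]; simp [Matrix.transpose_mul, hΩ, Matrix.mul_assoc]
  have hK0 : K = 0 := by
    ext i j
    by_cases hij : i = j
    · subst hij
      have := congrFun (congrFun hskew i) i
      simp only [Matrix.transpose_apply, Matrix.neg_apply] at this
      simp only [Matrix.zero_apply]; linarith
    · have := congrFun (congrFun hcomm i) j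
      rw [Matrix.diagonal_mul, Matrix.mul_diagonal] at this
      have hd : d i - d j ≠ 0 := sub_ne_zero.2 fun h => hij (h3 h)
      have h0 : (d i - d j) * K i j = 0 := by linarith
      simpa [hd] using h0
  calc Ω = (U * Uᵀ) * Ω * (U * Uᵀ) := by simp [h2]
    _ = U * K * Uᵀ := by rw [hK]; simp only [Matrix.mul_assoc]
    _ = 0 := by simp [hK0]

/-! ### Symmetric bilinear forms -/

/-- A symmetric bilinear form that is positive somewhere has a positive eigenvalue with respect to
an inner product. -/
theorem exists_pos_eigenvector {V : Type*} [AddCommGroup V] [Module ℝ V] [FiniteDimensional ℝ V]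
    (g h : V →ₗ[ℝ] V →ₗ[ℝ] ℝ) (gs : ∀ x y, g x y = g y x) (gpos : ∀ x, 0 ≤ g x x)
    (gdef : ∀ x, g x x = 0 → x = 0) (hs : ∀ x y, h x y = h y x) {v : V} (hv : 0 < h v v) :
    ∃ c : ℝ, 0 < c ∧ ∃ x : V, x ≠ 0 ∧ ∀ y, h x y = c * g x y := by
  let core : InnerProductSpace.Core ℝ V :=
    { inner := fun x y => g x y
      conj_inner_symm := fun x y => by simp [gs x y]
      re_inner_nonneg := fun x => by simpa using gpos x
      add_left := fun x y z => by simp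
      smul_left := fun x y r => by simp
      definite := fun x hx => gdef x hx }
  let _ : NormedAddCommGroup V := core.toNormedAddCommGroup
  let _ : InnerProductSpace ℝ V := InnerProductSpace.ofCore core.toCore
  have hinner : ∀ x y : V, inner ℝ x y = g x y := fun x y => rfl
  have : CompleteSpace V := FiniteDimensional.complete ℝ V
  -- The self-adjoint operator with `g (T x) y = h x y`, from the Riesz isomorphism for the inner
  -- product `g`.
  let T : V →ₗ[ℝ] V :=
    { toFun := fun x => (InnerProductSpace.toDual ℝ V).symm (LinearMap.toContinuousLinearMap (h x))
      map_add' := fun x y => by simp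
      map_smul' := fun r x => by simp }
  have hT : ∀ x y, inner ℝ (T x) y = h x y := fun x y => by
    simp [T, InnerProductSpace.toDual_symm_apply]
  have hsym : T.IsSymmetric := fun x y => by
    rw [hT, real_inner_comm, hT, hs]
  let b := hsym.eigenvectorBasis rfl
  -- Expansion in an orthonormal eigenbasis: positivity of the sum forces a positive eigenvalue.
  have hsum : h v v = ∑ i, hsym.eigenvalues rfl i * (inner ℝ (b i) v) ^ 2 := by
    rw [← hT, ← b.sum_inner_mul_inner (T v) v]
    refine Finset.sum_congr rfl fun i _ => ?_
    rw [hsym v (b i), hsym.apply_eigenvectorBasis, RCLike.ofReal_real_eq_id, id, inner_smul_right, real_inner_comm]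
    ring
  obtain ⟨i, -, hi⟩ : ∃ i ∈ Finset.univ, 0 < hsym.eigenvalues rfl i * (inner ℝ (b i) v) ^ 2 := by
    by_contra! hcon
    exact absurd (Finset.sum_nonpos hcon) (by rw [← hsum]; exact not_le.2 hv)
  refine ⟨hsym.eigenvalues rfl i, pos_of_mul_pos_left hi (sq_nonneg _), b i, ?_, fun y => ?_⟩
  · exact b.toBasis.ne_zero i |> fun h => by simpa using h
  · rw [← hT, hsym.apply_eigenvectorBasis, RCLike.ofReal_real_eq_id, id, real_inner_smul_left, hinner]

/-! ### Symmetric matrices with constant diagonal -/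

section Rotation

variable {n : Type*} [Fintype n] [DecidableEq n]

/-- The rotation by the angle with cosine `c` and sine `s` in the plane of the coordinates
`i, j`. -/
def planeRotation (i j : n) (c s : ℝ) : Matrix n n ℝ :=
  Matrix.of fun k => if k = i then c • Pi.single i 1 + s • Pi.single j 1
    else if k = j then (-s) • Pi.single i 1 + c • Pi.single j 1 else Pi.single k 1

theorem planeRotation_mul_apply (i j : n) (c s : ℝ) (A : Matrix n n ℝ) (k l : n) :
    (planeRotation i j c s * A) k l = if k = i then c * A i l + s * A j l
      else if k = j then -s * A i l + c * A j l else A k l := by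
  rw [Matrix.mul_apply]
  unfold planeRotation
  simp only [Matrix.of_apply]
  split_ifs <;> simp [add_mul, Finset.sum_add_distrib, Pi.single_apply]

theorem planeRotation_mul_transpose {i j : n} (hij : i ≠ j) {c s : ℝ} (h : c ^ 2 + s ^ 2 = 1) :
    planeRotation i j c s * (planeRotation i j c s)ᵀ = 1 := by
  ext k l
  rw [planeRotation_mul_apply]
  simp only [Matrix.transpose_apply, planeRotation, Matrix.of_apply, Matrix.one_apply]
  have hji := hij.symm
  split_ifs <;> subst_vars <;> simp_all <;> linarith

theorem conj_planeRotation_apply (i j : n) (c s : ℝ) (M : Matrix n n ℝ) (k : n) :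
    (planeRotation i j c s * M * (planeRotation i j c s)ᵀ) k k =
      if k = i then c * (c * M i i + s * M j i) + s * (c * M i j + s * M j j)
      else if k = j then -s * (-s * M i i + c * M j i) + c * (-s * M i j + c * M j j)
      else M k k := by
  have : (planeRotation i j c s * M * (planeRotation i j c s)ᵀ) =
      (planeRotation i j c s * (planeRotation i j c s * M)ᵀ)ᵀ := by
    simp [Matrix.transpose_mul, Matrix.mul_assoc]
  rw [this, Matrix.transpose_apply, planeRotation_mul_apply]
  simp only [Matrix.transpose_apply, planeRotation_mul_apply]
  split_ifs <;> rfl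

/-- Under rotation in the `(i, j)`-plane the `i`-th diagonal entry moves continuously from `M i i`
at angle 0 to `M j j` at angle `π / 2`, so it takes the value `m` in between. -/
theorem exists_conj_diag_eq {M : Matrix n n ℝ} (hM : M.IsSymm) {i j : n} {m : ℝ}
    (hi : M i i < m) (hj : m < M j j) :
    ∃ N : Matrix n n ℝ, N.IsSymm ∧ N.charpoly = M.charpoly ∧ N.trace = M.trace ∧ N i i = m ∧
      ∀ k, k ≠ i → k ≠ j → N k k = M k k := by
  have hij : i ≠ j := by rintro rfl; linarith
  let f : ℝ → ℝ := fun θ => Real.cos θ * (Real.cos θ * M i i + Real.sin θ * M j i) +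
    Real.sin θ * (Real.cos θ * M i j + Real.sin θ * M j j)
  have hf : Continuous f := by fun_prop
  obtain ⟨θ, hθ⟩ : ∃ θ, f θ = m :=
    mem_range_of_exists_le_of_exists_ge hf ⟨0, by simp [f, hi.le]⟩ ⟨Real.pi / 2, by simp [f, hj.le]⟩
  have h1 := planeRotation_mul_transpose hij (Real.cos_sq_add_sin_sq θ)
  have h2 := mul_eq_one_comm.1 h1
  set U := planeRotation i j (Real.cos θ) (Real.sin θ) with hU
  refine ⟨U * M * Uᵀ, ?_, ?_, ?_, ?_, ?_⟩
  · simp [Matrix.IsSymm, Matrix.transpose_mul, Matrix.mul_assoc, hM.eq]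
  · rw [Matrix.charpoly_mul_comm, ← Matrix.mul_assoc, h2, Matrix.one_mul]
  · rw [Matrix.trace_mul_comm, ← Matrix.mul_assoc, h2, Matrix.one_mul]
  · rw [hU, conj_planeRotation_apply, if_pos rfl]
    exact hθ
  · intro k hki hkj
    rw [hU, conj_planeRotation_apply, if_neg hki, if_neg hkj]

/-- Every isospectral class of real symmetric matrices contains a matrix with constant diagonal. -/
theorem exists_constant_diag {M : Matrix n n ℝ} (hM : M.IsSymm) {m : ℝ}
    (hm : M.trace = Fintype.card n * m) :
    ∃ N : Matrix n n ℝ, N.IsSymm ∧ N.charpoly = M.charpoly ∧ ∀ i, N i i = m := by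
  -- Induction on the number of diagonal entries different from `m`. By the trace condition there
  -- are entries on both sides of `m`; one rotation repairs one of them and touches only two
  -- positions.
  induction hk : (Finset.univ.filter fun i => M i i ≠ m).card using Nat.strong_induction_on
    generalizing M with
  | _ k ih =>
  by_cases hall : ∀ i, M i i = m
  · exact ⟨M, hM, rfl, hall⟩
  push Not at hall
  obtain ⟨i₀, hi₀⟩ := hall
  have hsum : ∑ i, (M i i - m) = 0 := by
    rw [Finset.sum_sub_distrib]
    simpa [sub_eq_zero, Matrix.trace] using hm
  obtain ⟨j, -, hj⟩ := Finset.exists_pos_of_sum_zero_of_exists_nonzero _ hsum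
    ⟨i₀, Finset.mem_univ _, sub_ne_zero.2 hi₀⟩
  obtain ⟨i, -, hi⟩ := Finset.exists_pos_of_sum_zero_of_exists_nonzero (fun i => -(M i i - m))
    (by rw [Finset.sum_neg_distrib, hsum, neg_zero])
    ⟨i₀, Finset.mem_univ _, neg_ne_zero.2 (sub_ne_zero.2 hi₀)⟩
  have hi' : M i i < m := by linarith
  have hj' : m < M j j := by linarith
  obtain ⟨N, h1, h2, h3, h4, h5⟩ := exists_conj_diag_eq hM hi' hj'
  have hlt : (Finset.univ.filter fun i => N i i ≠ m).card < k := by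
    rw [← hk]
    refine Finset.card_lt_card ((Finset.ssubset_iff_of_subset fun l hl => ?_).2 ⟨i, ?_, ?_⟩)
    · simp only [Finset.mem_filter, Finset.mem_univ, true_and] at hl ⊢
      by_cases hli : l = i
      · exact absurd (hli ▸ h4) hl
      by_cases hlj : l = j
      · rw [hlj]; exact hj'.ne'
      · rwa [← h5 l hli hlj]
    · simpa using hi'.ne
    · simpa using h4
  obtain ⟨N', h1', h2', h3'⟩ := ih _ hlt h1 (h3.trans hm) rfl
  exact ⟨N', h1', h2'.trans h2, h3'⟩

end Rotation

theorem exists_mem_isospectral_diag_eq_mean {A : Finset ℝ} (hA : A.Nonempty) :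
    ∃ M ∈ isospectral A, ∀ i, M i i = mean A := by
  let e := A.equivFin.symm
  have hsum : ∀ {β : Type} [AddCommMonoid β] (f : ℝ → β), ∑ i, f (e i) = ∑ x ∈ A, f x := by
    intro β _ f
    rw [e.sum_comp (fun x : A => f x)]
    exact Finset.sum_coe_sort A f
  have hprod : ∏ i, (Polynomial.X - Polynomial.C (e i : ℝ)) =
      ∏ x ∈ A, (Polynomial.X - Polynomial.C x) := by
    rw [e.prod_comp (fun x : A => Polynomial.X - Polynomial.C (x : ℝ))]
    exact Finset.prod_coe_sort A (fun x => Polynomial.X - Polynomial.C x)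
  have hc : (A.card : ℝ) ≠ 0 := by exact_mod_cast hA.card_pos.ne'
  obtain ⟨N, h1, h2, h3⟩ := exists_constant_diag
    (Matrix.isSymm_diagonal fun i => (e i : ℝ)) (m := mean A) (by
      rw [Matrix.trace_diagonal, hsum fun x => x, mean, Fintype.card_fin]
      field_simp)
  exact ⟨N, ⟨h1, by rw [h2, Matrix.charpoly_diagonal, hprod]⟩, h3⟩

variable {Λ : Finset ℝ}

/-! ### Critical manifolds -/

/-- The permutation is absorbed into the numbering of the rows, so that only block matrices in an
arbitrary numbering remain. -/
theorem exists_equiv_of_isCriticalManifold {E : Set (Mat Λ)} (hE : IsCriticalManifold E) :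
    ∃ (α : OrderedPartition Λ) (e : Fin Λ.card ≃ (p : Fin α.k) × Fin (α.part p).card),
      ∀ H, H ∈ E ↔ ∃ B : (p : Fin α.k) → Mat (α.part p),
        (∀ p, B p ∈ isospectral (α.part p)) ∧ (∀ p i, B p i i = mean (α.part p)) ∧
          H = (Matrix.blockDiagonal' B).submatrix e e := by
  obtain ⟨α, σ, rfl⟩ := hE
  have hconj : ∀ H : Mat Λ, (σ.permMatrix ℝ)ᵀ * H * σ.permMatrix ℝ =
      H.submatrix σ.symm σ.symm := by
    intro H
    rw [Matrix.transpose_permMatrix, Equiv.Perm.permMatrix, Equiv.Perm.permMatrix,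
      PEquiv.toMatrix_toPEquiv_mul, PEquiv.mul_toMatrix_toPEquiv, Matrix.submatrix_submatrix]
    rfl
  refine ⟨α, σ.symm.trans α.index.symm, fun H => ⟨?_, ?_⟩⟩
  · rintro ⟨_, ⟨B, h1, h2, rfl⟩, rfl⟩
    exact ⟨B, h1, h2, hconj _⟩
  · rintro ⟨B, h1, h2, rfl⟩
    exact ⟨_, ⟨B, h1, h2, rfl⟩, hconj _⟩

theorem IsCriticalManifold.nonempty {E : Set (Mat Λ)} (hE : IsCriticalManifold E) :
    E.Nonempty := by
  obtain ⟨α, e, h⟩ := exists_equiv_of_isCriticalManifold hE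
  choose B h1 h2 using fun p => exists_mem_isospectral_diag_eq_mean (α.nonempty p)
  exact ⟨_, (h _).2 ⟨B, h1, h2, rfl⟩⟩

theorem IsCriticalManifold.hasSimpleSpectrumIn {E : Set (Mat Λ)} (hE : IsCriticalManifold E)
    {H : Mat Λ} (hH : H ∈ E) : ∃ S, HasSimpleSpectrumIn H S := by
  obtain ⟨α, e, h⟩ := exists_equiv_of_isCriticalManifold hE
  obtain ⟨B, h1, -, rfl⟩ := (h H).1 hH
  refine ⟨_, (HasSimpleSpectrumIn.blockDiagonal'
    (fun p => hasSimpleSpectrumIn_of_mem_isospectral (h1 p)) fun p q hpq => ?_).submatrix e⟩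
  exact Finset.disjoint_coe.2 (α.disjoint p q hpq)

/-- The matrices of a critical manifold have a common diagonal, and commute with it. -/
theorem IsCriticalManifold.exists_diag {E : Set (Mat Λ)} (hE : IsCriticalManifold E) :
    ∃ δ : Fin Λ.card → ℝ, ∀ H ∈ E, (∀ i, H i i = δ i) ∧ ∀ i j, δ i ≠ δ j → H i j = 0 := by
  obtain ⟨α, e, h⟩ := exists_equiv_of_isCriticalManifold hE
  refine ⟨fun i => mean (α.part (e i).1), fun H hH => ?_⟩
  obtain ⟨B, -, h2, rfl⟩ := (h H).1 hH
  refine ⟨fun i => ?_, fun i j hij => ?_⟩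
  · rw [Matrix.submatrix_apply, Matrix.blockDiagonal'_apply_eq, h2]
  · rw [Matrix.submatrix_apply]
    exact Matrix.blockDiagonal'_apply_ne _ _ _ fun hp => hij (congrArg (fun p => mean (α.part p)) hp)

/-- Such a matrix is scalar, so its characteristic polynomial has a single root, while its roots are
the elements of `A`. -/
theorem card_le_one_of_isDiag {A : Finset ℝ} {M : Mat A} (hM : M ∈ isospectral A)
    (hd : ∀ i, M i i = mean A) (hdiag : M.IsDiag) : A.card ≤ 1 := by
  have hM' : M = Matrix.diagonal fun _ => mean A := by
    rw [← hdiag.diagonal_diag]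
    congr 1
    exact funext hd
  have hroots := congrArg Polynomial.roots hM.2
  rw [hM', Matrix.charpoly_diagonal, Polynomial.roots_prod_X_sub_C] at hroots
  rw [Finset.card_le_one]
  have hall : ∀ x ∈ A, x = mean A := by
    intro x hx
    have hx' : x ∈ A.val := hx
    rw [← hroots, Finset.prod_const, Polynomial.roots_pow, Polynomial.roots_X_sub_C] at hx'
    exact Multiset.mem_singleton.1 (Multiset.mem_of_mem_nsmul hx')
  intro x hx y hy
  rw [hall x hx, hall y hy]

theorem IsCriticalManifold.eq_singleton_of_isDiag {E : Set (Mat Λ)} (hE : IsCriticalManifold E)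
    {H : Mat Λ} (hH : H ∈ E) (hdiag : H.IsDiag) : E = {H} := by
  obtain ⟨α, e, h⟩ := exists_equiv_of_isCriticalManifold hE
  obtain ⟨B, h1, h2, rfl⟩ := (h H).1 hH
  have hB : ∀ p, (B p).IsDiag := by
    intro p i j hij
    have := hdiag (i := e.symm ⟨p, i⟩) (j := e.symm ⟨p, j⟩) (by simpa using hij)
    simpa [Matrix.submatrix_apply, Matrix.blockDiagonal'_apply_eq] using this
  refine Set.eq_singleton_iff_unique_mem.2 ⟨hH, fun K hK => ?_⟩
  obtain ⟨C, -, h2', rfl⟩ := (h K).1 hK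
  have : C = B := by
    funext p
    ext i j
    have hs : Subsingleton (Fin (α.part p).card) :=
      Fin.subsingleton_iff_le_one.2 (card_le_one_of_isDiag (h1 p) (h2 p) (hB p))
    rw [Subsingleton.elim j i, h2, h2']
  rw [this]

/-! ### Commutators of matrices -/

section Commutator

variable {n : Type*} [Fintype n]

theorem commutator_add (X Y Z : Matrix n n ℝ) : ⁅X, Y + Z⁆ = ⁅X, Y⁆ + ⁅X, Z⁆ := by
  simp only [Ring.lie_def, mul_add, add_mul]; abel

theorem add_commutator (X Y Z : Matrix n n ℝ) : ⁅X + Y, Z⁆ = ⁅X, Z⁆ + ⁅Y, Z⁆ := by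
  simp only [Ring.lie_def, mul_add, add_mul]; abel

theorem commutator_smul (c : ℝ) (X Y : Matrix n n ℝ) : ⁅X, c • Y⁆ = c • ⁅X, Y⁆ := by
  simp only [Ring.lie_def, mul_smul_comm, smul_mul_assoc, smul_sub]

theorem smul_commutator (c : ℝ) (X Y : Matrix n n ℝ) : ⁅c • X, Y⁆ = c • ⁅X, Y⁆ := by
  simp only [Ring.lie_def, mul_smul_comm, smul_mul_assoc, smul_sub]

theorem commutator_sub (X Y Z : Matrix n n ℝ) : ⁅X, Y - Z⁆ = ⁅X, Y⁆ - ⁅X, Z⁆ := by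
  simp only [Ring.lie_def, mul_sub, sub_mul]; abel

theorem commutator_skew (X Y : Matrix n n ℝ) : -⁅Y, X⁆ = ⁅X, Y⁆ := by
  simp only [Ring.lie_def, neg_sub]

/-- `tr(D [X, Y]) = tr([D, X] Y)`. -/
theorem trace_mul_lie (D X Y : Matrix n n ℝ) :
    (D * ⁅X, Y⁆).trace = (⁅D, X⁆ * Y).trace := by
  simp only [Ring.lie_def, Matrix.mul_sub, Matrix.sub_mul, Matrix.trace_sub]
  rw [Matrix.trace_mul_comm D (Y * X), Matrix.mul_assoc Y X D, Matrix.trace_mul_comm Y,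
    Matrix.mul_assoc, Matrix.mul_assoc]

theorem sum_mul_diag_eq_trace [DecidableEq n] (d : n → ℝ)
    (X : Matrix n n ℝ) : ∑ i, d i * X i i = (Matrix.diagonal d * X).trace := by
  simp [Matrix.trace, Matrix.diagonal_mul]

theorem lie_diagonal_eq_zero [DecidableEq n] {δ : n → ℝ}
    {X : Matrix n n ℝ} (h : ∀ i j, δ i ≠ δ j → X i j = 0) : ⁅Matrix.diagonal δ, X⁆ = 0 := by
  ext i j
  rw [Ring.lie_def, Matrix.sub_apply, Matrix.diagonal_mul, Matrix.mul_diagonal, Matrix.zero_apply]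
  by_cases hij : δ i = δ j
  · rw [hij]; ring
  · rw [h i j hij]; ring

end Commutator

/-! ### The Hessian -/

theorem lineDeriv_potential (K Z : Mat Λ) :
    lineDeriv ℝ potential K Z = ∑ i, K i i * Z i i := by
  apply HasLineDerivAt.lineDeriv
  unfold HasLineDerivAt potential
  have h : ∀ i ∈ Finset.univ, HasDerivAt (fun t : ℝ => ((K + t • Z) i i) ^ 2)
      (2 * (K i i * Z i i)) 0 := by
    intro i _
    have h1 : HasDerivAt (fun t : ℝ => K i i + t * Z i i) (1 * Z i i) 0 :=
      ((hasDerivAt_id (0 : ℝ)).mul_const (Z i i)).const_add _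
    exact (h1.fun_pow 2).congr_deriv (by simp; ring)
  refine ((HasDerivAt.fun_sum h).const_mul (1 / 2 : ℝ)).congr_deriv ?_
  rw [← Finset.mul_sum]; ring

/-- Product rule: with `adInv H Y` fixed, both factors are affine along `H + t X`. -/
theorem hessian_eq (H X Y : Mat Λ) :
    hessian H X Y = ∑ i, (X i i * ⁅H, adInv H Y⁆ i i + H i i * ⁅X, adInv H Y⁆ i i) := by
  unfold hessian
  simp_rw [lineDeriv_potential]
  apply HasLineDerivAt.lineDeriv
  unfold HasLineDerivAt
  refine HasDerivAt.fun_sum fun i _ => ?_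
  have h1 : HasDerivAt (fun t : ℝ => H i i + t * X i i) (1 * X i i) 0 :=
    ((hasDerivAt_id (0 : ℝ)).mul_const _).const_add _
  have h2 : HasDerivAt (fun t : ℝ => ⁅H, adInv H Y⁆ i i + t * ⁅X, adInv H Y⁆ i i)
      (1 * ⁅X, adInv H Y⁆ i i) 0 :=
    ((hasDerivAt_id (0 : ℝ)).mul_const _).const_add _
  refine ((h1.fun_mul h2).congr_deriv (by simp)).congr_of_eventuallyEq (.of_forall fun t => ?_)
  simp [add_commutator, smul_commutator]

theorem adInv_spec {H X : Mat Λ} (hX : X ∈ tangentSpace H) :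
    (adInv H X)ᵀ = -adInv H X ∧ ⁅H, adInv H X⁆ = X := by
  have h : ∃ Ω : Mat Λ, Ωᵀ = -Ω ∧ ⁅H, Ω⁆ = X := hX
  rw [adInv, dif_pos h]
  exact h.choose_spec

theorem adInv_lie {H : Mat Λ} {S : Set ℝ} (hH : HasSimpleSpectrumIn H S) {Ω : Mat Λ}
    (hΩ : Ωᵀ = -Ω) : adInv H ⁅H, Ω⁆ = Ω := by
  obtain ⟨h1, h2⟩ := adInv_spec (H := H) (X := ⁅H, Ω⁆) ⟨Ω, hΩ, rfl⟩
  refine sub_eq_zero.1 (hH.eq_zero_of_lie_eq_zero ?_ ?_)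
  · rw [Matrix.transpose_sub, h1, hΩ]; abel
  · rw [commutator_sub, h2, sub_self]

theorem neg_trace_mul_self_eq {Ω : Mat Λ} (hΩ : Ωᵀ = -Ω) :
    -(Ω * Ω).trace = ∑ i, ∑ j, Ω i j ^ 2 := by
  have h : -(Ω * Ω).trace = (Ω * Ωᵀ).trace := by rw [hΩ, Matrix.mul_neg, Matrix.trace_neg]
  rw [h]
  simp [Matrix.trace, Matrix.mul_apply, sq]

theorem eq_zero_of_neg_trace_mul_self {Ω : Mat Λ} (hΩ : Ωᵀ = -Ω) (h : -(Ω * Ω).trace ≤ 0) :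
    Ω = 0 := by
  rw [neg_trace_mul_self_eq hΩ] at h
  have h0 : ∀ i, 0 ≤ ∑ j, Ω i j ^ 2 := fun i => Finset.sum_nonneg fun j _ => sq_nonneg _
  have h1 := (Finset.sum_eq_zero_iff_of_nonneg fun i _ => h0 i).1
    (le_antisymm h (Finset.sum_nonneg fun i _ => h0 i))
  ext i j
  have h2 := (Finset.sum_eq_zero_iff_of_nonneg fun j _ => sq_nonneg _).1
    (h1 i (Finset.mem_univ i)) j (Finset.mem_univ j)
  simpa using h2

/-! ### Stability of diagonal matrices -/

/-- For diagonal `H` the bracket `[H, Ω]` has zero diagonal, so only the term `-tr(X Xᵀ)` of the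
Hessian survives. An eigenvector for `c > 0` then satisfies `c * g(X, X) ≤ 0`, hence vanishes. -/
theorem coindexAt_eq_zero_of_isDiag {E : Set (Mat Λ)} {H : Mat Λ} (hH : H.IsDiag) :
    coindexAt E H = 0 := by
  obtain ⟨d, rfl⟩ : ∃ d, H = Matrix.diagonal d := ⟨_, hH.diagonal_diag.symm⟩
  have hzero : (⋃ c ∈ Set.Ioi (0 : ℝ), eigenvectors E (Matrix.diagonal d) c) ⊆ {0} := by
    simp only [Set.iUnion_subset_iff]
    rintro c hc X ⟨hXN, hX⟩
    obtain ⟨hskew, hlie⟩ := adInv_spec hXN.1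
    have hess : hessian (Matrix.diagonal d) X X ≤ 0 := by
      have hdiag : ∀ i, X i i = 0 := by
        intro i
        rw [← hlie, Ring.lie_def, Matrix.sub_apply, Matrix.diagonal_mul, Matrix.mul_diagonal]
        ring
      have hsymm : Xᵀ = X := by
        rw [← hlie, Ring.lie_def, Matrix.transpose_sub, Matrix.transpose_mul, Matrix.transpose_mul,
          hskew, Matrix.diagonal_transpose]
        simp only [Matrix.neg_mul, Matrix.mul_neg]; abel
      have h1 : hessian (Matrix.diagonal d) X X = -(X * Xᵀ).trace := by
        rw [hessian_eq]
        simp only [hdiag, zero_mul, zero_add, Matrix.diagonal_apply_eq]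
        rw [sum_mul_diag_eq_trace, ← commutator_skew, Matrix.mul_neg, Matrix.trace_neg, trace_mul_lie,
          hlie, hsymm]
      rw [h1, neg_nonpos]
      simp only [Matrix.trace, Matrix.diag_apply, Matrix.mul_apply, Matrix.transpose_apply]
      exact Finset.sum_nonneg fun i _ => Finset.sum_nonneg fun j _ => mul_self_nonneg _
    rw [hX X hXN] at hess
    have hA := eq_zero_of_neg_trace_mul_self hskew (nonpos_of_mul_nonpos_right hess hc)
    rw [Set.mem_singleton_iff, ← hlie, hA, Ring.lie_def, Matrix.mul_zero, Matrix.zero_mul, sub_zero]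
  rw [coindexAt, Submodule.span_eq_bot.2 fun x hx => hzero hx, finrank_bot]

/-! ### Instability of the other critical manifolds -/

/-- The skew symmetric matrices. -/
def skew (Λ : Finset ℝ) : Submodule ℝ (Mat Λ) where
  carrier := {Ω | Ωᵀ = -Ω}
  add_mem' {a b} ha hb := by
    simp only [Set.mem_ofPred_eq] at *; rw [Matrix.transpose_add, ha, hb]; abel
  zero_mem' := by simp
  smul_mem' c a ha := by simp only [Set.mem_ofPred_eq] at *; simp [ha]

/-- The form `(Ω₁, Ω₂) ↦ -tr(Ω₁ Ω₂)` on skew symmetric matrices. -/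
def killing (Λ : Finset ℝ) : skew Λ →ₗ[ℝ] skew Λ →ₗ[ℝ] ℝ :=
  LinearMap.mk₂ ℝ (fun A B => -((A : Mat Λ) * (B : Mat Λ)).trace)
    (fun _ _ _ => by simp [add_mul]; ring) (fun _ _ _ => by simp)
    (fun _ _ _ => by simp [mul_add]; ring) (fun _ _ _ => by simp)

/-- The Hessian at `H`, in terms of skew symmetric matrices. -/
def skewHessian (H : Mat Λ) : skew Λ →ₗ[ℝ] skew Λ →ₗ[ℝ] ℝ :=
  LinearMap.mk₂ ℝ (fun A B => ∑ i, (⁅H, (A : Mat Λ)⁆ i i * ⁅H, (B : Mat Λ)⁆ i i +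
      H i i * ⁅⁅H, (A : Mat Λ)⁆, (B : Mat Λ)⁆ i i))
    (fun _ _ _ => by
      rw [← Finset.sum_add_distrib]
      refine Finset.sum_congr rfl fun i _ => ?_
      simp only [Submodule.coe_add, commutator_add, add_commutator, Matrix.add_apply]; ring)
    (fun _ _ _ => by
      rw [smul_eq_mul, Finset.mul_sum]
      refine Finset.sum_congr rfl fun i _ => ?_
      simp only [Submodule.coe_smul, commutator_smul, smul_commutator, Matrix.smul_apply, smul_eq_mul]; ring)
    (fun _ _ _ => by
      rw [← Finset.sum_add_distrib]
      refine Finset.sum_congr rfl fun i _ => ?_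
      simp only [Submodule.coe_add, commutator_add, Matrix.add_apply]; ring)
    (fun _ _ _ => by
      rw [smul_eq_mul, Finset.mul_sum]
      refine Finset.sum_congr rfl fun i _ => ?_
      simp only [Submodule.coe_smul, commutator_smul, Matrix.smul_apply, smul_eq_mul]; ring)

theorem skewHessian_apply (H : Mat Λ) (A B : skew Λ) :
    skewHessian H A B = ∑ i, ⁅H, (A : Mat Λ)⁆ i i * ⁅H, (B : Mat Λ)⁆ i i +
      (Matrix.diagonal (fun i => H i i) * ⁅⁅H, (A : Mat Λ)⁆, (B : Mat Λ)⁆).trace := by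
  rw [← sum_mul_diag_eq_trace, ← Finset.sum_add_distrib]
  rfl

theorem hessian_lie {H : Mat Λ} {S : Set ℝ} (hH : HasSimpleSpectrumIn H S) (A B : skew Λ) :
    hessian H ⁅H, (A : Mat Λ)⁆ ⁅H, (B : Mat Λ)⁆ = skewHessian H A B := by
  rw [hessian_eq, adInv_lie hH B.2]
  rfl

theorem normalMetric_lie {H : Mat Λ} {S : Set ℝ} (hH : HasSimpleSpectrumIn H S) (A B : skew Λ) :
    normalMetric H ⁅H, (A : Mat Λ)⁆ ⁅H, (B : Mat Λ)⁆ = killing Λ A B := by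
  rw [normalMetric, adInv_lie hH A.2, adInv_lie hH B.2]
  rfl

/-- By the Jacobi identity the two sides differ by `tr(D [H, [A, B]]) = tr([D, H] [A, B])`, and `D`
commutes with `H`. -/
theorem skewHessian_comm {H : Mat Λ} (hH : ∀ i j, H i i ≠ H j j → H i j = 0) (A B : skew Λ) :
    skewHessian H A B = skewHessian H B A := by
  rw [skewHessian_apply, skewHessian_apply]
  congr 1
  · exact Finset.sum_congr rfl fun i _ => mul_comm _ _
  · have h1 : ⁅⁅H, (A : Mat Λ)⁆, (B : Mat Λ)⁆ =
        ⁅H, ⁅(A : Mat Λ), (B : Mat Λ)⁆⁆ + ⁅⁅H, (B : Mat Λ)⁆, (A : Mat Λ)⁆ := by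
      simp only [Ring.lie_def]; noncomm_ring
    rw [h1, Matrix.mul_add, Matrix.trace_add, trace_mul_lie, lie_diagonal_eq_zero hH]
    simp

/-- A rotation in the plane of two coordinates that are coupled by `H` increases the diagonal
potential. -/
theorem exists_skewHessian_pos {H : Mat Λ} (hs : H.IsSymm) {i j : Fin Λ.card} (hij : i ≠ j)
    (hH : H i j ≠ 0) (hδ : H i i = H j j) : ∃ A : skew Λ, 0 < skewHessian H A A := by
  -- The infinitesimal rotation in the `(i, j)`-plane; it commutes with the diagonal part of `H`
  -- since `H i i = H j j`.
  obtain ⟨A, hA⟩ : ∃ A : Mat Λ, A = Matrix.single i j 1 - Matrix.single j i 1 := ⟨_, rfl⟩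
  have hAs : Aᵀ = -A := by simp [hA]
  refine ⟨⟨A, hAs⟩, ?_⟩
  rw [skewHessian_apply]
  have hA0 : ∀ k l, H k k ≠ H l l → A k l = 0 := by
    intro k l hkl
    simp only [hA, Matrix.sub_apply, Matrix.single_apply]
    rw [if_neg, if_neg, sub_zero]
    · rintro ⟨rfl, rfl⟩; exact hkl hδ.symm
    · rintro ⟨rfl, rfl⟩; exact hkl hδ
  change 0 < _ + (Matrix.diagonal (fun i => H i i) * ⁅⁅H, A⁆, A⁆).trace
  rw [← commutator_skew ⁅H, A⁆ A, Matrix.mul_neg, Matrix.trace_neg, trace_mul_lie,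
    lie_diagonal_eq_zero hA0, Matrix.zero_mul, Matrix.trace_zero, neg_zero, add_zero]
  have hii : ⁅H, A⁆ i i = -2 * H i j := by
    have := hs.apply i j
    rw [Ring.lie_def, Matrix.sub_apply, hA, Matrix.mul_sub, Matrix.sub_mul]
    simp [hij, this]
    ring
  refine Finset.sum_pos' (fun k _ => mul_self_nonneg _) ⟨i, Finset.mem_univ i, ?_⟩
  rw [hii]
  exact mul_self_pos.2 (mul_ne_zero (by norm_num) hH)

/-- The prescribed entries are constant along any curve in `E`, so their derivatives vanish. -/
theorem IsCriticalManifold.tangentVectors_apply {E : Set (Mat Λ)} {δ : Fin Λ.card → ℝ}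
    (hδ : ∀ H ∈ E, (∀ i, H i i = δ i) ∧ ∀ i j, δ i ≠ δ j → H i j = 0) {H X : Mat Λ}
    (hX : X ∈ tangentVectors E H) : (∀ i, X i i = 0) ∧ ∀ i j, δ i ≠ δ j → X i j = 0 := by
  obtain ⟨γ, -, hγ, -, hd⟩ := hX
  refine ⟨fun i => ?_, fun i j hij => ?_⟩
  · rw [hd, funext fun t => (hδ _ (hγ t)).1 i, deriv_const]
  · rw [hd, funext fun t => (hδ _ (hγ t)).2 i j hij, deriv_const]

theorem IsCriticalManifold.isDiag_of_coindexAt_eq_zero {E : Set (Mat Λ)}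
    (hE : IsCriticalManifold E) {H : Mat Λ} (hH : H ∈ E) (h0 : coindexAt E H = 0) : H.IsDiag := by
  obtain ⟨δ, hδ⟩ := hE.exists_diag
  obtain ⟨S, hS⟩ := hE.hasSimpleSpectrumIn hH
  obtain ⟨hd, hb⟩ := hδ H hH
  have hb' : ∀ i j, H i i ≠ H j j → H i j = 0 := fun i j h => hb i j (by rwa [← hd, ← hd])
  by_contra hdiag
  obtain ⟨i, j, hij, hne⟩ : ∃ i j, i ≠ j ∧ H i j ≠ 0 := by
    by_contra! hcon
    exact hdiag fun i j hij => hcon i j hij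
  obtain ⟨v, hv⟩ := exists_skewHessian_pos hS.isSymm hij hne (not_imp_comm.1 (hb' i j) hne)
  obtain ⟨c, hc, A, hA, heig⟩ := exists_pos_eigenvector (killing Λ) (skewHessian H)
    (fun A B => congrArg Neg.neg (Matrix.trace_mul_comm _ _))
    (fun A => by
      change 0 ≤ -((A : Mat Λ) * (A : Mat Λ)).trace
      rw [neg_trace_mul_self_eq A.2]
      exact Finset.sum_nonneg fun i _ => Finset.sum_nonneg fun j _ => sq_nonneg _)
    (fun A hA => Subtype.ext (eq_zero_of_neg_trace_mul_self A.2 (le_of_eq hA)))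
    (skewHessian_comm hb') hv
  -- For `Y = [H, B]` tangent to `E`, both terms of the Hessian vanish: `Y` has zero diagonal and
  -- commutes with `D`. Hence `c * g([H, A], Y) = 0` with `c > 0`.
  have hnormal : ⁅H, (A : Mat Λ)⁆ ∈ normalSpace E H := by
    refine ⟨⟨A, A.2, rfl⟩, fun Y hY => ?_⟩
    by_cases hYt : Y ∈ tangentSpace H
    · obtain ⟨Ω, hΩ, rfl⟩ := hYt
      obtain ⟨ht1, ht2⟩ := tangentVectors_apply hδ hY
      let B : skew Λ := ⟨Ω, hΩ⟩
      have h1 : skewHessian H A B = 0 := by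
        rw [skewHessian_comm hb', skewHessian_apply, trace_mul_lie, funext hd,
          lie_diagonal_eq_zero ht2, Matrix.zero_mul, Matrix.trace_zero, add_zero]
        exact Finset.sum_eq_zero fun i _ => by rw [ht1 i, zero_mul]
      rw [heig] at h1
      exact (normalMetric_lie hS A B).trans ((mul_eq_zero.1 h1).resolve_left hc.ne')
    -- Outside the tangent space `adInv` takes its default value 0, so the pairing is trivially zero
    -- and no tangency of curves in `E` to `Sym(Λ)` has to be proved.
    · rw [normalMetric, show adInv H Y = 0 from dif_neg hYt, Matrix.mul_zero, Matrix.trace_zero,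
        neg_zero]
  have hmem : ⁅H, (A : Mat Λ)⁆ ∈ eigenvectors E H c := by
    refine ⟨hnormal, fun Y hY => ?_⟩
    obtain ⟨Ω, hΩ, rfl⟩ := hY.1
    exact (hessian_lie hS A ⟨Ω, hΩ⟩).trans ((heig _).trans
      (congrArg _ (normalMetric_lie hS A ⟨Ω, hΩ⟩).symm))
  have hspan := Submodule.finrank_eq_zero.1 h0
  have := Submodule.span_eq_bot.1 hspan _ (Set.mem_biUnion (Set.mem_Ioi.2 hc) hmem)
  exact hA (Subtype.ext (hS.eq_zero_of_lie_eq_zero A.2 this))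

end DiagonalPotential

end

theorem mainTheorem5 (Λ : Finset ℝ) (hΛ : DiagonalPotential.StronglyDisjoint Λ)
    (E : Set (DiagonalPotential.Mat Λ)) (hE : DiagonalPotential.IsCriticalManifold E) :
    ((∃ H ∈ E, DiagonalPotential.coindexAt E H = 0) ↔
      ∃ D : DiagonalPotential.Mat Λ, D.IsDiag ∧ E = {D}) ∧
    ((∀ H ∈ E, DiagonalPotential.coindexAt E H = 0) ↔
      ∃ D : DiagonalPotential.Mat Λ, D.IsDiag ∧ E = {D}) := by
  have hdown : (∃ H ∈ E, DiagonalPotential.coindexAt E H = 0) →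
      ∃ D : DiagonalPotential.Mat Λ, D.IsDiag ∧ E = {D} := by
    rintro ⟨H, hH, h0⟩
    have hdiag := hE.isDiag_of_coindexAt_eq_zero hH h0
    exact ⟨H, hdiag, hE.eq_singleton_of_isDiag hH hdiag⟩
  have hup : (∃ D : DiagonalPotential.Mat Λ, D.IsDiag ∧ E = {D}) →
      ∀ H ∈ E, DiagonalPotential.coindexAt E H = 0 := by
    rintro ⟨D, hD, rfl⟩ H rfl
    exact DiagonalPotential.coindexAt_eq_zero_of_isDiag hD
  -- Without a point of `E`, co-index 0 everywhere could hold vacuously; the point comes from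
  -- realizing each `Λ_p` as the spectrum of a symmetric matrix with constant diagonal.
  obtain ⟨H₀, hH₀⟩ := hE.nonempty
  exact ⟨⟨hdown, fun h => ⟨H₀, hH₀, hup h H₀ hH₀⟩⟩,
    ⟨fun h => hdown ⟨H₀, hH₀, h H₀ hH₀⟩, hup⟩⟩
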